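/- Let $X\sim\mathcal N(\mu_0,\Sigma_0)$ in $\mathbb R^d$, where $\Sigma_0$ is positive definite with an orthonormal basis of eigenvectors $q_1,\dots,q_d$ and eigenvalues $\lambda_1,\dots,\lambda_d>0$, and let $N\sim\mathcal N(0,I)$ be independent of $X$. Let $0=\beta_0\le\beta_1\le\dots\le\beta_T<1$, $\alpha_k=1-\beta_k$, $\bar\alpha_k=\prod_{i=1}^k\alpha_i$, and let $p_k$ be the probability density of $\sqrt{\bar\alpha_k}X+\sqrt{1-\bar\alpha_k}N$. Fix $t\in\{1,\dots,T\}$, put $Z_t=\sqrt{\bar\alpha_t}X+\sqrt{1-\bar\alpha_t}N$ and $\lambda_\ell^{(t)}=\bar\alpha_t\lambda_\ell+1-\bar\alpha_t$. For $P\ge 0$ let $$D_t(P)=\min_{p_{\hat X|Z_t}}\mathbb E\|X-\hat X\|_2^2\quad\text{subject to}\quad W_2^2(p_X,p_{\hat X})\le P,$$ the minimum being over all conditional laws of $\hat X$ given $Z_t$ (with $X$ and $\hat X$ conditionally independent given $Z_t$), and let $$S=\sum_{i=1}^d\frac{\lambda_i}{\lambda_i^{(t)}}\Big(\sqrt{\lambda_i^{(t)}}-\sqrt{\bar\alpha_t}\sqrt{\lambda_i}\Big)^2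 .$$ Then for every $P\ge 0$ the minimum is attained and $$D_t(P)=\Big(\max\big\{\sqrt S-\sqrt P,\,0\big\}\Big)^2+\sum_{\ell=1}^d\frac{(1-\bar\alpha_t)\lambda_\ell}{\lambda_\ell^{(t)}},$$ and there are $\rho_1,\dots,\rho_d\in[0,1]$ such that the per-dimension score-scaled probability flow ODE iteration started at $Z_t$, $$Z_k=\frac1{\sqrt{1-\beta_{k+1}}}\Big(Z_{k+1}+\tfrac12\beta_{k+1}\sum_{\ell=1}^d(2-\rho_\ell)\,\big\langle q_\ell,\nabla\log p_{k+1}(Z_{k+1})\big\rangle\, q_\ell\Big),\qquad k=t-1,\dots,0,$$ produces a reconstruction $\hat X=Z_0$ with $\mathbb E\|X-\hat X\|_2^2=D_t(P)$ and $W_2^2(p_X,p_{\hat X})=\min\{P,S\}\le P$. -/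

import Mathlib

open MeasureTheory ProbabilityTheory
open scoped ENNReal

noncomputable section

namespace ScoreScaledODE

/-- `ᾱ_k = ∏_{i=1}^k α_i` with `α_i = 1 - β_i`. -/
def alphaBar (β : ℕ → ℝ) (k : ℕ) : ℝ := ∏ i ∈ Finset.Icc 1 k, (1 - β i)

/-- The variance `ᾱ_k λ + (1 - ᾱ_k)` of the noised variable, in an eigen-direction of the source
covariance with eigenvalue `lam`. -/
def eigVar (β : ℕ → ℝ) (k : ℕ) (lam : ℝ) : ℝ := alphaBar β k * lam + (1 - alphaBar β k)

section Tradeoff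

variable {E : Type*} [NormedAddCommGroup E] [InnerProductSpace ℝ E] [MeasurableSpace E]

/-- The noised observation `√ᾱ_k X + √(1 - ᾱ_k) N`. -/
def noised {Ω : Type*} (β : ℕ → ℝ) (X N : Ω → E) (k : ℕ) (ω : Ω) : E :=
  √(alphaBar β k) • X ω + √(1 - alphaBar β k) • N ω

/-- The squared Wasserstein-2 distance, an infimum over all couplings. -/
def W2sq (μ ν : Measure E) : ℝ≥0∞ :=
  ⨅ (π : Measure (E × E)) (_ : π.fst = μ) (_ : π.snd = ν), ∫⁻ z, ‖z.1 - z.2‖ₑ ^ 2 ∂π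

/-- The mean squared error `𝔼 ‖X - X'‖²`. -/
def mse {Ω : Type*} [MeasurableSpace Ω] (Pr : Measure Ω) (X X' : Ω → E) : ℝ≥0∞ :=
  ∫⁻ ω, ‖X ω - X' ω‖ₑ ^ 2 ∂Pr

/-- The mean squared error `𝔼 ‖X - X̂‖²` of a randomized reconstruction: given `(X, Z)`, the
reconstruction `X̂` is drawn from `κ Z`. -/
def kernelMse {Ω : Type*} [MeasurableSpace Ω] (Pr : Measure Ω) (X Z : Ω → E) (κ : Kernel E E) :
    ℝ≥0∞ :=
  ∫⁻ ω, ∫⁻ x', ‖X ω - x'‖ₑ ^ 2 ∂(κ (Z ω)) ∂Pr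

/-- The set of distortions `𝔼 ‖X - X̂‖²` over all conditional laws `p_{X̂ | Z}` (Markov kernels)
for which the law of `X̂` satisfies `W₂²(p_X, p_X̂) ≤ P`. -/
def feasibleDistortions {Ω : Type*} [MeasurableSpace Ω] (Pr : Measure Ω) (X Z : Ω → E) (P : ℝ) :
    Set ℝ≥0∞ :=
  {D | ∃ κ : Kernel E E, IsMarkovKernel κ ∧
    W2sq (Pr.map X) ((Pr.map Z).bind κ) ≤ ENNReal.ofReal P ∧ D = kernelMse Pr X Z κ}

end Tradeoff

/-- `p` is a continuous probability density of `μ` with respect to Lebesgue measure. -/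
def IsContinuousDensity {F : Type*} [NormedAddCommGroup F] [MeasureSpace F]
    (μ : Measure F) (p : F → ℝ) : Prop :=
  Continuous p ∧ (∀ z, 0 ≤ p z) ∧ μ = volume.withDensity (fun z => ENNReal.ofReal (p z))

/-- A continuous density is unique, so that `density` below does not depend on a choice. -/
theorem IsContinuousDensity.unique {F : Type*} [NormedAddCommGroup F] [MeasureSpace F]
    [BorelSpace F] [SigmaFinite (volume : Measure F)] [(volume : Measure F).IsOpenPosMeasure]
    {μ : Measure F} {p q : F → ℝ}
    (hp : IsContinuousDensity μ p) (hq : IsContinuousDensity μ q) : p = q := by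
  obtain ⟨hpc, hp0, hp⟩ := hp
  obtain ⟨hqc, hq0, hq⟩ := hq
  have h := (withDensity_eq_iff_of_sigmaFinite
    (hpc.measurable.ennreal_ofReal.aemeasurable)
    (hqc.measurable.ennreal_ofReal.aemeasurable)).1 (hp.symm.trans hq)
  refine (Continuous.ae_eq_iff_eq (volume : Measure F) hpc hqc).1 ?_
  filter_upwards [h] with z hz
  exact (ENNReal.ofReal_eq_ofReal_iff (hp0 z) (hq0 z)).1 hz

open Classical in
/-- The continuous Lebesgue density of `μ` (and `0` if there is none). -/
def density {F : Type*} [NormedAddCommGroup F] [MeasureSpace F] (μ : Measure F) : F → ℝ :=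
  if h : ∃ p, IsContinuousDensity μ p then h.choose else 0

/-- The score `∇ log p_μ`. -/
def score {F : Type*} [NormedAddCommGroup F] [InnerProductSpace ℝ F] [CompleteSpace F]
    [MeasureSpace F] (μ : Measure F) (z : F) : F :=
  gradient (fun y => Real.log (density μ y)) z

/-- One step of the score-scaled probability flow ODE iteration,
`z ↦ (z + (1/2) β (2 - ρ) ∇ log p(z)) / √(1 - β)`,
where the factor `2 - ρ_ℓ` acts on the component of the score along the basis vector `q_ℓ`. -/
def odeStep {d : ℕ} (q : OrthonormalBasis (Fin d) ℝ (EuclideanSpace ℝ (Fin d)))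
    (ρ : Fin d → ℝ) (b : ℝ) (μ : Measure (EuclideanSpace ℝ (Fin d)))
    (z : EuclideanSpace ℝ (Fin d)) : EuclideanSpace ℝ (Fin d) :=
  (1 / √(1 - b)) •
    (z + ∑ l, ((1 / 2) * (2 - ρ l) * b * inner ℝ (q l) (score μ z)) • q l)

/-- The output `Z_0` of the iteration started from `Z_t = z`: for `k = t - 1, …, 0`, the point
`Z_k` is obtained from `Z_{k+1}` by the step with `β_{k+1}` and the score of `p (k + 1)`,
where `p k` is the law of the forward (noised) variable at time `k`. -/
def odeDecode {d : ℕ} (q : OrthonormalBasis (Fin d) ℝ (EuclideanSpace ℝ (Fin d)))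
    (ρ : Fin d → ℝ) (β : ℕ → ℝ) (p : ℕ → Measure (EuclideanSpace ℝ (Fin d))) :
    ℕ → EuclideanSpace ℝ (Fin d) → EuclideanSpace ℝ (Fin d)
  | 0, z => z
  | k + 1, z => odeDecode q ρ β p k (odeStep q ρ (β (k + 1)) (p (k + 1)) z)

/-- `S = ∑_i (λ_i / λ_i^{(t)}) (√λ_i^{(t)} - √ᾱ_t √λ_i)²`, the perception level above which the
perception constraint is inactive. -/
def critPerception {d : ℕ} (β : ℕ → ℝ) (t : ℕ) (lam : Fin d → ℝ) : ℝ :=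
  ∑ i, lam i / eigVar β t (lam i) *
    (√(eigVar β t (lam i)) - √(alphaBar β t) * √(lam i)) ^ 2

/-- The closed form of the distortion-perception tradeoff; for `P ≤ S` the maximum is `√S - √P`. -/
def closedForm {d : ℕ} (β : ℕ → ℝ) (t : ℕ) (lam : Fin d → ℝ) (P : ℝ) : ℝ :=
  (max (√(critPerception β t lam) - √P) 0) ^ 2 +
    ∑ l, (1 - alphaBar β t) * lam l / eigVar β t (lam l)

end ScoreScaledODE

end

/-! Everything is diagonal in the eigenbasis `q`. The coordinates of X and Z_t are independent
Gaussians, and X = U + B(Z_t), where B is the affine conditional mean and U is a centered Gaussian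
independent of Z_t (`indepFun_mmse_residual_noised`). Hence the distortion of any randomized
reconstruction is the total variance of U plus the mean squared distance from X̂ to B(Z_t)
(`kernelMse_eq_add`).

The pair (B(Z_t), X̂) couples two laws, the first of them Gaussian with the same mean m as X. The
reverse triangle inequality in L², applied in each coordinate, bounds any transport cost from such a
Gaussian by the root second moments s_l of the other marginal around m (`le_lintegral_coupling`).
With a_l = `mmseStd`, this leaves a problem about three points of ℝ^d: s lies within √P of (√λ_l),
the distance from (√λ_l) to a is √S (`critPerception_eq`), and the distance from s to a is to be
minimized. The triangle inequality gives the lower bound. A point s on the segment from (√λ_l) to a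
attains it (`exists_optimal_std`), and is realized by an affine decoder with gains s_l / √λ_l^(t).

The score of a Gaussian is affine, so the iteration is itself a diagonal affine map that preserves
the mean (`odeDecode_diagGaussian`). Its gain depends continuously on ρ_l. At ρ_l = 0 it is exactly
the gain of the conditional mean, and at ρ_l = 1 it is at least the variance preserving gain. The
intermediate value theorem then yields each gain s_l / √λ_l^(t). -/

noncomputable section

namespace ScoreScaledODE

/-! ### Coordinates in an orthonormal basis. -/

section OrthonormalBasis

variable {E : Type*} [NormedAddCommGroup E] [InnerProductSpace ℝ E] {ι : Type*} [Fintype ι]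

theorem inner_sum_smul_basis (q : OrthonormalBasis ι ℝ E) (x : ι → ℝ) (l : ι) :
    inner ℝ (q l) (∑ i, x i • q i) = x l := by
  classical
  simp [inner_sum, inner_smul_right, q.inner_eq_ite]

theorem ext_inner_basis (q : OrthonormalBasis ι ℝ E) {x y : E}
    (h : ∀ l, inner ℝ (q l) x = inner ℝ (q l) y) : x = y := by
  rw [← q.sum_repr' x, ← q.sum_repr' y]
  simp [h]

theorem enorm_sq_eq_sum (q : OrthonormalBasis ι ℝ E) (x : E) :
    ‖x‖ₑ ^ 2 = ∑ l, ENNReal.ofReal (inner ℝ (q l) x ^ 2) := by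
  rw [← ofReal_norm, ← ENNReal.ofReal_pow (norm_nonneg _), ← q.sum_sq_inner_right,
    ENNReal.ofReal_sum_of_nonneg fun _ _ => sq_nonneg _]

end OrthonormalBasis

/-! ### Gaussian measures with independent coordinates in a fixed basis. -/

section DiagGaussian

variable {E : Type*} [NormedAddCommGroup E] [InnerProductSpace ℝ E] [FiniteDimensional ℝ E]
  [MeasurableSpace E] [BorelSpace E] {ι : Type*} [Fintype ι]

/-- The Gaussian measure whose coordinates in the orthonormal basis `q` are independent with
means `m l` and variances `v l`. -/
def diagGaussian (q : OrthonormalBasis ι ℝ E) (m v : ι → ℝ) : Measure E :=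
  (Measure.pi fun l => gaussianReal (m l) (v l).toNNReal).map fun x => ∑ l, x l • q l

/-- The affine map acting on the coordinate along `q l` by `x ↦ c l * x + f l`. -/
def diagAffine (q : OrthonormalBasis ι ℝ E) (c f : ι → ℝ) (z : E) : E :=
  ∑ l, (c l * inner ℝ (q l) z + f l) • q l

omit [FiniteDimensional ℝ E] [MeasurableSpace E] [BorelSpace E] in
@[simp]
theorem inner_diagAffine (q : OrthonormalBasis ι ℝ E) (c f : ι → ℝ) (z : E) (l : ι) :
    inner ℝ (q l) (diagAffine q c f z) = c l * inner ℝ (q l) z + f l :=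
  inner_sum_smul_basis q _ l

@[fun_prop]
theorem measurable_diagAffine (q : OrthonormalBasis ι ℝ E) (c f : ι → ℝ) :
    Measurable (diagAffine q c f) := by
  unfold diagAffine
  fun_prop

theorem measurable_sum_smul_basis (q : OrthonormalBasis ι ℝ E) :
    Measurable fun x : ι → ℝ => ∑ l, x l • q l := by
  fun_prop

instance isProbabilityMeasure_diagGaussian (q : OrthonormalBasis ι ℝ E) (m v : ι → ℝ) :
    IsProbabilityMeasure (diagGaussian q m v) :=
  Measure.isProbabilityMeasure_map (measurable_sum_smul_basis q).aemeasurable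

theorem map_inner_diagGaussian (q : OrthonormalBasis ι ℝ E) (m v : ι → ℝ) (l : ι) :
    (diagGaussian q m v).map (fun z => inner ℝ (q l) z)
      = gaussianReal (m l) (v l).toNNReal := by
  rw [diagGaussian, Measure.map_map (by fun_prop) (measurable_sum_smul_basis q)]
  have : ((fun z => inner ℝ (q l) z) ∘ fun x : ι → ℝ => ∑ l, x l • q l) = Function.eval l := by
    ext x
    simp [inner_sum_smul_basis]
  rw [this]
  exact (measurePreserving_eval _ l).map_eq

/-- Fubini factors the integral over the independent coordinates. Nonnegativity of `v` is needed
because `Real.toNNReal` truncates negative variances to 0. -/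
theorem charFun_diagGaussian (q : OrthonormalBasis ι ℝ E) (m : ι → ℝ) {v : ι → ℝ}
    (hv : ∀ l, 0 ≤ v l) (t : E) :
    charFun (diagGaussian q m v) t
      = ∏ l, Complex.exp (inner ℝ (q l) t * m l * Complex.I
          - v l * (inner ℝ (q l) t : ℝ) ^ 2 / 2) := by
  rw [charFun_apply, diagGaussian,
    integral_map (measurable_sum_smul_basis q).aemeasurable
      (Measurable.aestronglyMeasurable (by fun_prop))]
  have h : ∀ x : ι → ℝ, Complex.exp ((inner ℝ (∑ l, x l • q l) t : ℝ) * Complex.I)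
      = ∏ l, Complex.exp (inner ℝ (x l) (inner ℝ (q l) t) * Complex.I) := by
    intro x
    rw [← Complex.exp_sum, ← Finset.sum_mul, sum_inner]
    congr 2
    push_cast
    refine Finset.sum_congr rfl fun l _ => ?_
    simp [real_inner_smul_left, mul_comm]
  simp_rw [h]
  rw [integral_fintype_prod_eq_prod
    (f := fun l (x : ℝ) => Complex.exp (inner ℝ x (inner ℝ (q l) t) * Complex.I))]
  refine Finset.prod_congr rfl fun l _ => ?_
  rw [← charFun_apply, charFun_gaussianReal]
  simp [Real.coe_toNNReal _ (hv l)]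

theorem diagGaussian_map_diagAffine (q : OrthonormalBasis ι ℝ E) (m : ι → ℝ) {v : ι → ℝ}
    (c f : ι → ℝ) :
    (diagGaussian q m v).map (diagAffine q c f)
      = diagGaussian q (fun l => c l * m l + f l) (fun l => c l ^ 2 * v l) := by
  have h : ∀ l, (gaussianReal (m l) (v l).toNNReal).map (fun x => c l * x + f l)
      = gaussianReal (c l * m l + f l) (c l ^ 2 * v l).toNNReal := by
    intro l
    have : (fun x : ℝ => c l * x + f l) = (fun x => x + f l) ∘ fun x => c l * x := rfl
    rw [this, ← Measure.map_map (by fun_prop) (by fun_prop), gaussianReal_map_const_mul,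
      gaussianReal_map_add_const]
    congr 1
    rw [Real.toNNReal_mul (sq_nonneg _)]
    congr 1
    exact (Real.toNNReal_of_nonneg (sq_nonneg (c l))).symm
  have hpi := Measure.pi_map_pi (μ := fun l => gaussianReal (m l) (v l).toNNReal)
    (f := fun l x => c l * x + f l) (fun l => by fun_prop)
    (hμ := fun l => by rw [h]; infer_instance)
  rw [diagGaussian, diagGaussian, Measure.map_map (by fun_prop) (measurable_sum_smul_basis q)]
  simp_rw [← h]
  rw [← hpi, Measure.map_map (measurable_sum_smul_basis q) (by fun_prop)]
  congr 1
  ext x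
  simp [diagAffine, inner_sum_smul_basis]

theorem map_add_diagGaussian {Ω : Type*} [MeasurableSpace Ω] {Pr : Measure Ω}
    [IsProbabilityMeasure Pr] (q : OrthonormalBasis ι ℝ E) {X Y : Ω → E} {m v m' v' : ι → ℝ}
    (hv : ∀ l, 0 ≤ v l) (hv' : ∀ l, 0 ≤ v' l) (hX : AEMeasurable X Pr) (hY : AEMeasurable Y Pr)
    (hXl : Pr.map X = diagGaussian q m v) (hYl : Pr.map Y = diagGaussian q m' v')
    (h : IndepFun X Y Pr) :
    Pr.map (fun ω => X ω + Y ω) = diagGaussian q (m + m') (v + v') := by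
  have : IsProbabilityMeasure (Pr.map fun ω => X ω + Y ω) :=
    Measure.isProbabilityMeasure_map (hX.add hY)
  refine Measure.ext_of_charFun ?_
  rw [h.charFun_map_fun_add_eq_mul hX hY, hXl, hYl]
  ext t
  rw [Pi.mul_apply, charFun_diagGaussian q _ hv, charFun_diagGaussian q _ hv',
    charFun_diagGaussian q _ (v := v + v') (fun l => add_nonneg (hv l) (hv' l)), ← Finset.prod_mul_distrib]
  refine Finset.prod_congr rfl fun l _ => ?_
  rw [← Complex.exp_add]
  congr 1
  push_cast [Pi.add_apply]
  ring

theorem stdGaussian_eq_diagGaussian (q : OrthonormalBasis ι ℝ E) :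
    stdGaussian E = diagGaussian q 0 1 := by
  rw [stdGaussian_eq_map_pi_orthonormalBasis q, diagGaussian]
  simp

theorem integrable_sq_gaussianReal (m : ℝ) (v : NNReal) :
    Integrable (fun x => x ^ 2) (gaussianReal m v) :=
  (memLp_id_gaussianReal 2).integrable_sq

theorem integral_sq_gaussianReal (m : ℝ) (v : NNReal) :
    ∫ x, x ^ 2 ∂(gaussianReal m v) = m ^ 2 + v := by
  have h := variance_eq_sub (μ := gaussianReal m v) (X := id) (memLp_id_gaussianReal 2)
  rw [variance_id_gaussianReal] at h
  simp only [Pi.pow_apply, id, integral_id_gaussianReal] at h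
  linarith

theorem lintegral_enorm_sq_diagGaussian (q : OrthonormalBasis ι ℝ E) (m : ι → ℝ) {v : ι → ℝ}
    (hv : ∀ l, 0 ≤ v l) :
    ∫⁻ x, ‖x‖ₑ ^ 2 ∂(diagGaussian q m v) = ENNReal.ofReal (∑ l, (m l ^ 2 + v l)) := by
  simp_rw [enorm_sq_eq_sum q]
  rw [lintegral_finsetSum _ fun l _ => by fun_prop,
    ENNReal.ofReal_sum_of_nonneg fun l _ => add_nonneg (sq_nonneg _) (hv l)]
  refine Finset.sum_congr rfl fun l _ => ?_
  rw [← lintegral_map (f := fun x : ℝ => ENNReal.ofReal (x ^ 2)) (g := fun z => inner ℝ (q l) z)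
    (by fun_prop) (by fun_prop), map_inner_diagGaussian,
    ← ofReal_integral_eq_lintegral_ofReal (integrable_sq_gaussianReal _ _)
      (Filter.Eventually.of_forall fun x => sq_nonneg x), integral_sq_gaussianReal,
    Real.coe_toNNReal _ (hv l)]

end DiagGaussian

/-! ### Diagonalization of the source covariance. -/

section Multivariate

variable {d : ℕ} {S : Matrix (Fin d) (Fin d) ℝ}
  {q : OrthonormalBasis (Fin d) ℝ (EuclideanSpace ℝ (Fin d))} {lam : Fin d → ℝ}

theorem dotProduct_mulVec_eq_sum (hq : ∀ l, Matrix.toEuclideanLin S (q l) = lam l • q l)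
    (x : EuclideanSpace ℝ (Fin d)) :
    x.ofLp ⬝ᵥ S.mulVec x.ofLp = ∑ l, lam l * inner ℝ (q l) x ^ 2 := by
  have h1 : x.ofLp ⬝ᵥ S.mulVec x.ofLp = inner ℝ x (Matrix.toEuclideanLin S x) := by
    rw [EuclideanSpace.inner_eq_star_dotProduct, dotProduct_comm]
    simp
  have h2 : Matrix.toEuclideanLin S x = ∑ l, (lam l * inner ℝ (q l) x) • q l := by
    conv_lhs => rw [← q.sum_repr' x]
    simp [map_sum, hq, smul_smul, mul_comm]
  rw [h1, h2, inner_sum]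
  refine Finset.sum_congr rfl fun l _ => ?_
  rw [inner_smul_right, real_inner_comm]
  ring

theorem eigenvalue_pos (hS : S.PosDef)
    (hq : ∀ l, Matrix.toEuclideanLin S (q l) = lam l • q l) (l : Fin d) : 0 < lam l := by
  have h := dotProduct_mulVec_eq_sum hq (q l)
  have h2 := hS.dotProduct_mulVec_pos (x := (q l).ofLp) (by
    intro h0
    have : q l = 0 := by ext i; simp [h0]
    exact q.orthonormal.ne_zero l this)
  simp [q.inner_eq_ite] at h h2
  rwa [h] at h2

/-- The covariance form is diagonal in the eigenbasis, so the two characteristic functions coincide.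
-/
theorem multivariateGaussian_eq_diagGaussian (hS : S.PosDef)
    (hq : ∀ l, Matrix.toEuclideanLin S (q l) = lam l • q l) (μ : EuclideanSpace ℝ (Fin d)) :
    multivariateGaussian μ S = diagGaussian q (fun l => inner ℝ (q l) μ) lam := by
  refine Measure.ext_of_charFun ?_
  ext t
  rw [charFun_multivariateGaussian hS.posSemidef, dotProduct_mulVec_eq_sum hq,
    charFun_diagGaussian q _ fun l => (eigenvalue_pos hS hq l).le, ← Complex.exp_sum,
    ← q.sum_inner_mul_inner t μ]
  congr 1
  rw [Finset.sum_sub_distrib]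
  push_cast
  rw [Finset.sum_mul, Finset.sum_div]
  congr 1
  refine Finset.sum_congr rfl fun l _ => ?_
  rw [real_inner_comm t]

end Multivariate

/-! ### Gaussian densities and scores. -/

section Density

theorem pi_withDensity_ofReal {ι : Type*} [Fintype ι] {α : ι → Type*}
    [∀ i, MeasurableSpace (α i)] (μ : ∀ i, Measure (α i)) [∀ i, SigmaFinite (μ i)]
    (f : ∀ i, α i → ℝ) (hf0 : ∀ i x, 0 ≤ f i x)
    (hfi : ∀ i, Integrable (f i) (μ i)) :
    (Measure.pi fun i => (μ i).withDensity fun x => ENNReal.ofReal (f i x))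
      = (Measure.pi μ).withDensity fun x => ENNReal.ofReal (∏ i, f i (x i)) := by
  have : ∀ i, SigmaFinite ((μ i).withDensity fun x => ENNReal.ofReal (f i x)) := fun i =>
    SigmaFinite.withDensity_ofReal (f i)
  refine Measure.pi_eq fun s hs => ?_
  rw [withDensity_apply _ (MeasurableSet.univ_pi hs), Measure.restrict_pi_pi]
  have hint : Integrable (fun x : ∀ i, α i => ∏ i, f i (x i))
      (Measure.pi fun i => (μ i).restrict (s i)) :=
    Integrable.fintype_prod_dep fun i => (hfi i).restrict
  rw [← ofReal_integral_eq_lintegral_ofReal hint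
    (Filter.Eventually.of_forall fun x => Finset.prod_nonneg fun i _ => hf0 i _),
    integral_fintype_prod_eq_prod f,
    ENNReal.ofReal_prod_of_nonneg fun i _ => integral_nonneg (hf0 i)]
  refine Finset.prod_congr rfl fun i _ => ?_
  rw [withDensity_apply _ (hs i), ofReal_integral_eq_lintegral_ofReal (hfi i).restrict
    (Filter.Eventually.of_forall (hf0 i))]

variable {d : ℕ} (q : OrthonormalBasis (Fin d) ℝ (EuclideanSpace ℝ (Fin d)))

theorem measurePreserving_sum_smul_basis :
    MeasurePreserving (fun x : Fin d → ℝ => ∑ l, x l • q l) := by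
  have h := q.measurePreserving_repr_symm.comp (PiLp.volume_preserving_toLp (Fin d))
  have he : (fun x : Fin d → ℝ => ∑ l, x l • q l) = q.repr.symm ∘ WithLp.toLp 2 := by
    ext1 x
    rw [Function.comp_apply, ← q.sum_repr (q.repr.symm _)]
    simp
  rwa [he]

/-- The probability density of `diagGaussian q m v`. -/
def diagGaussianPDF (m v : Fin d → ℝ) (z : EuclideanSpace ℝ (Fin d)) : ℝ :=
  ∏ l, gaussianPDFReal (m l) (v l).toNNReal (inner ℝ (q l) z)

theorem isContinuousDensity_diagGaussian (m : Fin d → ℝ) {v : Fin d → ℝ} (hv : ∀ l, 0 < v l) :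
    IsContinuousDensity (diagGaussian q m v) (diagGaussianPDF q m v) := by
  refine ⟨?_, fun z => Finset.prod_nonneg fun l _ => gaussianPDFReal_nonneg _ _ _, ?_⟩
  · unfold diagGaussianPDF gaussianPDFReal
    fun_prop
  have hm : Measurable (diagGaussianPDF q m v) := by
    unfold diagGaussianPDF
    fun_prop
  have h : ∀ l, gaussianReal (m l) (v l).toNNReal
      = volume.withDensity fun x => ENNReal.ofReal (gaussianPDFReal (m l) (v l).toNNReal x) :=
    fun l => gaussianReal_of_var_ne_zero _ (by simpa using hv l)
  have hpi := pi_withDensity_ofReal (fun _ : Fin d => (volume : Measure ℝ))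
    (fun l => gaussianPDFReal (m l) (v l).toNNReal)
    (fun l => gaussianPDFReal_nonneg _ _) (fun l => integrable_gaussianPDFReal _ _)
  rw [diagGaussian]
  simp_rw [h]
  rw [hpi]
  ext s hs
  have hmp := measurePreserving_sum_smul_basis q
  rw [Measure.map_apply hmp.measurable hs, withDensity_apply _ (hmp.measurable hs),
    withDensity_apply _ hs, ← hmp.map_eq,
    setLIntegral_map hs hm.ennreal_ofReal hmp.measurable]
  simp [diagGaussianPDF, inner_sum_smul_basis, volume_pi]

theorem density_eq {F : Type*} [NormedAddCommGroup F] [MeasureSpace F]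
    [BorelSpace F] [SigmaFinite (volume : Measure F)] [(volume : Measure F).IsOpenPosMeasure]
    {μ : Measure F} {p : F → ℝ} (hp : IsContinuousDensity μ p) : density μ = p := by
  have h : ∃ p, IsContinuousDensity μ p := ⟨p, hp⟩
  rw [density, dif_pos h]
  exact h.choose_spec.unique hp

/-- Uniqueness of the continuous density replaces the chosen one by the explicit product, whose
logarithm is a sum of one-variable quadratics. -/
theorem score_diagGaussian (m : Fin d → ℝ) {v : Fin d → ℝ} (hv : ∀ l, 0 < v l)
    (z : EuclideanSpace ℝ (Fin d)) :
    score (diagGaussian q m v) z = ∑ l, (-(inner ℝ (q l) z - m l) / v l) • q l := by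
  rw [score, density_eq (isContinuousDensity_diagGaussian q m hv)]
  have hlog : (fun y => Real.log (diagGaussianPDF q m v y)) = fun y =>
      ∑ l, (Real.log (√(2 * Real.pi * (v l).toNNReal))⁻¹
        + -(inner ℝ (q l) y - m l) ^ 2 / (2 * v l)) := by
    ext y
    rw [diagGaussianPDF, Real.log_prod fun l _ =>
      (gaussianPDFReal_pos _ _ _ (by simpa using hv l)).ne']
    refine Finset.sum_congr rfl fun l _ => ?_
    have : (0 : ℝ) < (v l).toNNReal := by simpa using hv l
    rw [gaussianPDFReal, Real.log_mul (by positivity) (Real.exp_pos _).ne', Real.log_exp,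
      Real.coe_toNNReal _ (hv l).le]
  rw [hlog]
  refine HasGradientAt.gradient ?_
  rw [hasGradientAt_iff_hasFDerivAt, map_sum]
  refine HasFDerivAt.fun_sum fun l _ => ?_
  have h1 : HasFDerivAt (fun y => inner ℝ (q l) y - m l) (innerSL ℝ (q l)) z :=
    ((innerSL ℝ (q l)).hasFDerivAt).sub_const _
  have h2 := ((h1.pow 2).const_mul (-(1 / (2 * v l)))).const_add
    (Real.log (√(2 * Real.pi * (v l).toNNReal))⁻¹)
  convert h2 using 1
  · ext y
    ring
  · ext y
    have := (hv l).ne'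
    simp
    field_simp
    ring

end Density

/-! ### The iteration as a diagonal affine map, and the range of its gains. -/

section Iteration

variable {d : ℕ} (q : OrthonormalBasis (Fin d) ℝ (EuclideanSpace ℝ (Fin d)))

theorem odeStep_diagGaussian (ρ : Fin d → ℝ) (b : ℝ) (m : Fin d → ℝ) {v : Fin d → ℝ}
    (hv : ∀ l, 0 < v l) (z : EuclideanSpace ℝ (Fin d)) (l : Fin d) :
    inner ℝ (q l) (odeStep q ρ b (diagGaussian q m v) z)
      = 1 / √(1 - b) * (inner ℝ (q l) z
        - (1 - ρ l / 2) * b / v l * (inner ℝ (q l) z - m l)) := by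
  rw [odeStep, inner_smul_right, inner_add_right, inner_sum_smul_basis, score_diagGaussian q m hv,
    inner_sum_smul_basis]
  ring

/-- The factor by which the iteration from time `t` contracts deviations from the mean along an
eigen-direction with eigenvalue `lam` and score scale `r`. -/
def odeGain (β : ℕ → ℝ) (lam r : ℝ) (t : ℕ) : ℝ :=
  ∏ k ∈ Finset.range t,
    1 / √(1 - β (k + 1)) * (1 - (1 - r / 2) * β (k + 1) / eigVar β (k + 1) lam)

theorem odeGain_succ (β : ℕ → ℝ) (lam r : ℝ) (t : ℕ) :
    odeGain β lam r (t + 1) = odeGain β lam r t *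
      (1 / √(1 - β (t + 1)) * (1 - (1 - r / 2) * β (t + 1) / eigVar β (t + 1) lam)) :=
  Finset.prod_range_succ _ _

theorem alphaBar_succ (β : ℕ → ℝ) (k : ℕ) :
    alphaBar β (k + 1) = alphaBar β k * (1 - β (k + 1)) :=
  Finset.prod_Icc_succ_top (by omega) _

@[simp]
theorem alphaBar_zero (β : ℕ → ℝ) : alphaBar β 0 = 1 := by simp [alphaBar]

@[simp]
theorem eigVar_zero (β : ℕ → ℝ) (lam : ℝ) : eigVar β 0 lam = lam := by simp [eigVar]

theorem eigVar_succ (β : ℕ → ℝ) (k : ℕ) (lam : ℝ) :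
    eigVar β (k + 1) lam = (1 - β (k + 1)) * eigVar β k lam + β (k + 1) := by
  rw [eigVar, eigVar, alphaBar_succ]
  ring

theorem alphaBar_pos {β : ℕ → ℝ} {t : ℕ} (hβ : ∀ k < t, β (k + 1) < 1) : 0 < alphaBar β t := by
  induction t with
  | zero => simp
  | succ t ih =>
    rw [alphaBar_succ]
    exact mul_pos (ih fun k hk => hβ k (by omega)) (by linarith [hβ t (by omega)])

theorem alphaBar_le_one {β : ℕ → ℝ} {t : ℕ} (hβ : ∀ k < t, 0 ≤ β (k + 1) ∧ β (k + 1) < 1) :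
    alphaBar β t ≤ 1 := by
  induction t with
  | zero => simp
  | succ t ih =>
    rw [alphaBar_succ]
    have h0 := alphaBar_pos fun k hk => (hβ k (Nat.lt_succ_of_lt hk)).2
    exact mul_le_one₀ (ih fun k hk => hβ k (by omega)) (by linarith [(hβ t (by omega)).2])
      (by linarith [(hβ t (by omega)).1])

theorem eigVar_pos {β : ℕ → ℝ} {t : ℕ} (hβ : ∀ k < t, 0 ≤ β (k + 1) ∧ β (k + 1) < 1) {lam : ℝ}
    (hlam : 0 < lam) : 0 < eigVar β t lam := by
  have h0 := alphaBar_pos fun k hk => (hβ k hk).2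
  have h1 := alphaBar_le_one hβ
  rw [eigVar]
  have := mul_pos h0 hlam
  linarith

/-- The score vanishes at the mean √ᾱ_{k+1} m, so a step only rescales it by 1/√(1 - β_{k+1}), to
√ᾱ_k m. Means are thus carried to means, and deviations are multiplied by the gain. -/
theorem odeDecode_diagGaussian (ρ : Fin d → ℝ) {β : ℕ → ℝ} {t : ℕ}
    (hβ : ∀ k < t, 0 ≤ β (k + 1) ∧ β (k + 1) < 1) (m : Fin d → ℝ) {lam : Fin d → ℝ}
    (hlam : ∀ l, 0 < lam l) {p : ℕ → Measure (EuclideanSpace ℝ (Fin d))}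
    (hp : ∀ k ≤ t, p k = diagGaussian q (fun l => √(alphaBar β k) * m l)
      fun l => eigVar β k (lam l)) :
    odeDecode q ρ β p t = diagAffine q (fun l => odeGain β (lam l) (ρ l) t)
      fun l => m l - odeGain β (lam l) (ρ l) t * (√(alphaBar β t) * m l) := by
  induction t with
  | zero =>
    ext1 z
    refine ext_inner_basis q fun l => ?_
    simp [odeDecode, odeGain]
  | succ t ih =>
    ext1 z
    refine ext_inner_basis q fun l => ?_
    have hb := hβ t (by omega)
    have hs : 0 < √(1 - β (t + 1)) := Real.sqrt_pos.2 (by linarith [hb.2])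
    have hv := eigVar_pos hβ (hlam l)
    rw [odeDecode, ih (fun k hk => hβ k (by omega)) fun k hk => hp k (by omega),
      inner_diagAffine, hp _ le_rfl, odeStep_diagGaussian q _ _ _ fun l => eigVar_pos hβ (hlam l),
      inner_diagAffine, odeGain_succ, alphaBar_succ,
      Real.sqrt_mul (alphaBar_pos fun k hk => (hβ k (Nat.lt_succ_of_lt hk)).2).le]
    generalize odeGain β (lam l) (ρ l) t = G at *
    generalize eigVar β (t + 1) (lam l) = v at *
    generalize β (t + 1) = b at *
    generalize √(1 - b) = s at *
    field_simp
    ring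

theorem continuous_odeGain (β : ℕ → ℝ) (lam : ℝ) (t : ℕ) :
    Continuous fun r => odeGain β lam r t := by
  unfold odeGain
  fun_prop

/-- Since λ^(k+1) = (1 - β_{k+1}) λ^(k) + β_{k+1}, the factor at time k+1 is √(1 - β_{k+1}) λ^(k) /
λ^(k+1), and the product telescopes. -/
theorem odeGain_zero {β : ℕ → ℝ} {t : ℕ} (hβ : ∀ k < t, 0 ≤ β (k + 1) ∧ β (k + 1) < 1)
    {lam : ℝ} (hlam : 0 < lam) :
    odeGain β lam 0 t = √(alphaBar β t) * lam / eigVar β t lam := by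
  induction t with
  | zero => simp [odeGain, hlam.ne']
  | succ t ih =>
    have hb := hβ t (by omega)
    have hβ' := fun k hk => hβ k (Nat.lt_succ_of_lt hk)
    have hs : 0 < √(1 - β (t + 1)) := Real.sqrt_pos.2 (by linarith [hb.2])
    have hv := (eigVar_pos hβ hlam).ne'
    have hv' := (eigVar_pos hβ' hlam).ne'
    have ih := ih hβ'
    have hsq : √(1 - β (t + 1)) ^ 2 = 1 - β (t + 1) := Real.sq_sqrt (by linarith [hb.2])
    rw [odeGain_succ, ih, alphaBar_succ,
      Real.sqrt_mul (alphaBar_pos fun k hk => (hβ' k hk).2).le]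
    have hstep : 1 - (1 - (0 : ℝ) / 2) * β (t + 1) / eigVar β (t + 1) lam
        = √(1 - β (t + 1)) ^ 2 * eigVar β t lam / eigVar β (t + 1) lam := by
      rw [hsq]
      field_simp
      rw [eigVar_succ]
      ring
    rw [hstep]
    field_simp

/-- With x = β_{k+1} / λ^(k+1), each step reduces to √(1 - x) ≤ 1 - x/2, and the product of the
lower bounds telescopes. -/
theorem le_odeGain_one {β : ℕ → ℝ} {t : ℕ} (hβ : ∀ k < t, 0 ≤ β (k + 1) ∧ β (k + 1) < 1)
    {lam : ℝ} (hlam : 0 < lam) : √lam / √(eigVar β t lam) ≤ odeGain β lam 1 t := by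
  induction t with
  | zero => simp [odeGain, (Real.sqrt_pos.2 hlam).ne']
  | succ t ih =>
    have hb := hβ t (by omega)
    have hβ' := fun k hk => hβ k (Nat.lt_succ_of_lt hk)
    have h1 : 0 < 1 - β (t + 1) := by linarith [hb.2]
    have hv := eigVar_pos hβ hlam
    have hv' := eigVar_pos hβ' hlam
    have ih := ih hβ'
    rw [odeGain_succ]
    set v := eigVar β (t + 1) lam with hvdef
    set w := eigVar β t lam
    have hvw : v = (1 - β (t + 1)) * w + β (t + 1) := eigVar_succ _ _ _
    have hstep : √((1 - β (t + 1)) * w) / √v ≤ 1 - (1 - (1 : ℝ) / 2) * β (t + 1) / v := by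
      rw [← Real.sqrt_div (by positivity)]
      have hratio : β (t + 1) / v ≤ 1 := by
        rw [div_le_one hv, hvw]
        have := mul_pos h1 hv'
        linarith
      refine Real.sqrt_le_iff.2 ⟨?_, ?_⟩
      · rw [mul_div_assoc]
        linarith
      · have : (1 - β (t + 1)) * w / v = 1 - β (t + 1) / v := by
          field_simp
          linarith
        rw [this, mul_div_assoc]
        nlinarith [sq_nonneg (β (t + 1) / v)]
    have hsw := Real.sqrt_pos.2 hv'
    have hsv := Real.sqrt_pos.2 hv
    have hs1 := Real.sqrt_pos.2 h1
    calc √lam / √v = √lam / √w * (1 / √(1 - β (t + 1)) * (√((1 - β (t + 1)) * w) / √v)) := by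
          rw [Real.sqrt_mul h1.le]
          field_simp
      _ ≤ _ := by
          -- The gain accumulated so far is nonnegative, which the product of inequalities requires.
          have := ih.trans' (by positivity)
          gcongr

/-- Every gain between the minimum mean squared error gain and the variance preserving gain is
reached by some score scale in `[0, 1]`. -/
theorem exists_odeGain_eq {β : ℕ → ℝ} {t : ℕ} (hβ : ∀ k < t, 0 ≤ β (k + 1) ∧ β (k + 1) < 1)
    {lam g : ℝ} (hlam : 0 < lam) (hg : √(alphaBar β t) * lam / eigVar β t lam ≤ g)
    (hg' : g ≤ √lam / √(eigVar β t lam)) : ∃ r ∈ Set.Icc (0 : ℝ) 1, odeGain β lam r t = g :=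
  intermediate_value_Icc zero_le_one (continuous_odeGain β lam t).continuousOn
    ⟨(odeGain_zero hβ hlam).trans_le hg, hg'.trans (le_odeGain_one hβ hlam)⟩

end Iteration

/-! ### Transport costs and second moments. -/

section SecondMoments

/-- The reverse triangle inequality for the L² norm, squared. -/
theorem sq_sqrt_sub_sqrt_le_integral {α : Type*} [MeasurableSpace α] {μ : Measure α} {f g : α → ℝ}
    (hf : MemLp f 2 μ) (hg : MemLp g 2 μ) :
    (√(∫ x, f x ^ 2 ∂μ) - √(∫ x, g x ^ 2 ∂μ)) ^ 2 ≤ ∫ x, (f x - g x) ^ 2 ∂μ := by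
  have hinner : ∀ {p r : α → ℝ} (hp : MemLp p 2 μ) (hr : MemLp r 2 μ),
      inner ℝ (hp.toLp p) (hr.toLp r) = ∫ x, p x * r x ∂μ := by
    intro p r hp hr
    rw [L2.inner_def]
    refine integral_congr_ae ?_
    filter_upwards [hp.coeFn_toLp, hr.coeFn_toLp] with x h1 h2
    simp [h1, h2, mul_comm]
  have hsq : ∀ {p : α → ℝ} (hp : MemLp p 2 μ), ‖hp.toLp p‖ = √(∫ x, p x ^ 2 ∂μ) := by
    intro p hp
    rw [norm_eq_sqrt_real_inner, hinner]
    simp_rw [sq]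
  have h := abs_norm_sub_norm_le (hf.toLp f) (hg.toLp g)
  rw [← MemLp.toLp_sub hf hg, hsq, hsq, hsq] at h
  have h2 := pow_le_pow_left₀ (abs_nonneg _) h 2
  rwa [sq_abs, Real.sq_sqrt (integral_nonneg fun x => sq_nonneg _)] at h2

theorem memLp_two_of_lintegral_ne_top {α F : Type*} [MeasurableSpace α] [NormedAddCommGroup F]
    {μ : Measure α} {f : α → F} (hf : AEStronglyMeasurable f μ)
    (h : ∫⁻ x, ‖f x‖ₑ ^ 2 ∂μ ≠ ∞) : MemLp f 2 μ := by
  refine ⟨hf, (eLpNorm_lt_top_iff_lintegral_rpow_enorm_lt_top (by simp) (by simp)).2 ?_⟩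
  simpa using h.lt_top

variable {E : Type*} [NormedAddCommGroup E] [InnerProductSpace ℝ E] [FiniteDimensional ℝ E]
  [MeasurableSpace E] [BorelSpace E] {ι : Type*} [Fintype ι]

theorem memLp_id_diagGaussian (q : OrthonormalBasis ι ℝ E) (m : ι → ℝ) {v : ι → ℝ}
    (hv : ∀ l, 0 ≤ v l) : MemLp id 2 (diagGaussian q m v) := by
  refine memLp_two_of_lintegral_ne_top aestronglyMeasurable_id ?_
  simp only [id]
  rw [lintegral_enorm_sq_diagGaussian q m hv]
  exact ENNReal.ofReal_ne_top

theorem integral_centered_sq_diagGaussian (q : OrthonormalBasis ι ℝ E) (m : ι → ℝ) {v : ι → ℝ}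
    (hv : ∀ l, 0 ≤ v l) (l : ι) :
    ∫ x, (inner ℝ (q l) x - m l) ^ 2 ∂(diagGaussian q m v) = v l := by
  rw [← integral_map (φ := fun x => inner ℝ (q l) x) (f := fun y : ℝ => (y - m l) ^ 2)
    (by fun_prop) (by fun_prop), map_inner_diagGaussian]
  have h := variance_eq_integral (X := id) (μ := gaussianReal (m l) (v l).toNNReal) aemeasurable_id
  simp only [id, integral_id_gaussianReal] at h
  rw [← h, variance_id_gaussianReal, Real.coe_toNNReal _ (hv l)]

/-- The transport cost of a coupling of `diagGaussian q m v` with any measure is bounded below in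
terms of the second moments around `m` of that measure. -/
theorem le_lintegral_coupling (q : OrthonormalBasis ι ℝ E) (m : ι → ℝ) {v : ι → ℝ}
    (hv : ∀ l, 0 ≤ v l) {π : Measure (E × E)} (hπ : π.fst = diagGaussian q m v) :
    ENNReal.ofReal (∑ l, (√(v l) - √(∫ y, (inner ℝ (q l) y - m l) ^ 2 ∂π.snd)) ^ 2)
      ≤ ∫⁻ z, ‖z.1 - z.2‖ₑ ^ 2 ∂π := by
  -- At infinite cost there is nothing to prove. At finite cost the second marginal inherits a
  -- finite second moment from the first, so the integrals in the bound are genuine.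
  by_cases htop : ∫⁻ z, ‖z.1 - z.2‖ₑ ^ 2 ∂π = ∞
  · simp [htop]
  have : IsProbabilityMeasure π := ⟨by rw [← Measure.fst_univ, hπ, measure_univ]⟩
  have h1 : MemLp (fun z : E × E => z.1) 2 π := by
    have h := memLp_id_diagGaussian q m hv
    rw [← hπ, Measure.fst, memLp_map_measure_iff aestronglyMeasurable_id
      measurable_fst.aemeasurable] at h
    exact h
  have h12 : MemLp (fun z : E × E => z.1 - z.2) 2 π :=
    memLp_two_of_lintegral_ne_top (by fun_prop) htop
  have h2 : MemLp (fun z : E × E => z.2) 2 π := by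
    have h := h1.sub h12
    have he : (fun z : E × E => z.2) = (fun z => z.1) - fun z => z.1 - z.2 := by
      ext1 z
      simp
    rwa [he]
  have hA : ∀ l, MemLp (fun z : E × E => inner ℝ (q l) z.1 - m l) 2 π := fun l =>
    (h1.const_inner (q l)).sub (memLp_const _)
  have hB : ∀ l, MemLp (fun z : E × E => inner ℝ (q l) z.2 - m l) 2 π := fun l =>
    (h2.const_inner (q l)).sub (memLp_const _)
  simp_rw [enorm_sq_eq_sum q]
  rw [lintegral_finsetSum _ fun l _ => by fun_prop,
    ENNReal.ofReal_sum_of_nonneg fun l _ => sq_nonneg _]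
  refine Finset.sum_le_sum fun l _ => ?_
  have hv1 : v l = ∫ z, (inner ℝ (q l) z.1 - m l) ^ 2 ∂π := by
    rw [← integral_centered_sq_diagGaussian q m hv l, ← hπ, Measure.fst,
      integral_map measurable_fst.aemeasurable (by fun_prop)]
  have hv2 : ∫ y, (inner ℝ (q l) y - m l) ^ 2 ∂π.snd
      = ∫ z, (inner ℝ (q l) z.2 - m l) ^ 2 ∂π := by
    rw [Measure.snd, integral_map measurable_snd.aemeasurable (by fun_prop)]
  have he : ∀ z : E × E, inner ℝ (q l) (z.1 - z.2) ^ 2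
      = ((inner ℝ (q l) z.1 - m l) - (inner ℝ (q l) z.2 - m l)) ^ 2 := by
    intro z
    rw [inner_sub_right]
    ring
  simp_rw [he]
  have hint : Integrable (fun z : E × E =>
      ((inner ℝ (q l) z.1 - m l) - (inner ℝ (q l) z.2 - m l)) ^ 2) π :=
    ((hA l).sub (hB l)).integrable_sq
  rw [← ofReal_integral_eq_lintegral_ofReal hint
    (Filter.Eventually.of_forall fun z => sq_nonneg _), hv1, hv2]
  exact ENNReal.ofReal_le_ofReal (sq_sqrt_sub_sqrt_le_integral (hA l) (hB l))

theorem le_W2sq_diagGaussian (q : OrthonormalBasis ι ℝ E) (m : ι → ℝ) {v : ι → ℝ}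
    (hv : ∀ l, 0 ≤ v l) (ν : Measure E) :
    ENNReal.ofReal (∑ l, (√(v l) - √(∫ y, (inner ℝ (q l) y - m l) ^ 2 ∂ν)) ^ 2)
      ≤ W2sq (diagGaussian q m v) ν := by
  refine le_iInf fun π => le_iInf fun h1 => le_iInf fun h2 => ?_
  rw [← h2]
  exact le_lintegral_coupling q m hv h1

theorem W2sq_diagGaussian (q : OrthonormalBasis ι ℝ E) (m : ι → ℝ) {v w : ι → ℝ}
    (hv : ∀ l, 0 < v l) (hw : ∀ l, 0 ≤ w l) :
    W2sq (diagGaussian q m v) (diagGaussian q m w)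
      = ENNReal.ofReal (∑ l, (√(v l) - √(w l)) ^ 2) := by
  refine le_antisymm ?_ ?_
  -- The optimal coupling is the graph of the diagonal affine map that fixes the mean and rescales
  -- the standard deviations √v to √w.
  · set c : ι → ℝ := fun l => √(w l) / √(v l) with hc
    have hcv : ∀ l, c l * √(v l) = √(w l) := fun l =>
      div_mul_cancel₀ _ (Real.sqrt_pos.2 (hv l)).ne'
    set T := diagAffine q c fun l => m l - c l * m l with hT
    have hTm : Measurable T := measurable_diagAffine q _ _
    unfold W2sq
    refine iInf_le_of_le ((diagGaussian q m v).map fun x => (x, T x)) <|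
      iInf_le_of_le ?_ <| iInf_le_of_le ?_ ?_
    · rw [Measure.fst_map_prodMk hTm, Measure.map_id']
    · rw [Measure.snd_map_prodMk measurable_id', hT, diagGaussian_map_diagAffine]
      congr 1
      · ext l
        ring
      · ext l
        rw [← Real.sq_sqrt (hw l), ← hcv, mul_pow, Real.sq_sqrt (hv l).le]
    · rw [lintegral_map (by fun_prop) (by fun_prop)]
      have hsub : ∀ x, x - T x = diagAffine q (fun l => 1 - c l) (fun l => -(m l - c l * m l)) x := by
        intro x
        refine ext_inner_basis q fun l => ?_
        rw [inner_sub_right, hT, inner_diagAffine, inner_diagAffine]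
        ring
      simp_rw [hsub]
      rw [← lintegral_map (f := fun x => ‖x‖ₑ ^ 2) (by fun_prop) (measurable_diagAffine q _ _),
        diagGaussian_map_diagAffine, lintegral_enorm_sq_diagGaussian q _
          fun l => mul_nonneg (sq_nonneg _) (hv l).le]
      refine ENNReal.ofReal_le_ofReal (le_of_eq (Finset.sum_congr rfl fun l _ => ?_))
      rw [← hcv]
      nth_rewrite 1 [← Real.sq_sqrt (hv l).le]
      ring
  · have h := le_W2sq_diagGaussian q m (fun l => (hv l).le) (diagGaussian q m w)
    simp_rw [integral_centered_sq_diagGaussian q m hw] at h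
    exact h

end SecondMoments

/-! ### Independence from uncorrelatedness, and splitting of the distortion. -/

section Decomposition

variable {E : Type*} [NormedAddCommGroup E] [InnerProductSpace ℝ E] [FiniteDimensional ℝ E]
  [MeasurableSpace E] [BorelSpace E] {ι : Type*} [Fintype ι]
  {Ω : Type*} [MeasurableSpace Ω] {Pr : Measure Ω} [IsProbabilityMeasure Pr]

theorem map_diagAffine_add_diagAffine (q : OrthonormalBasis ι ℝ E) {X N : Ω → E}
    {m v m' v' : ι → ℝ} (hv : ∀ l, 0 ≤ v l) (hv' : ∀ l, 0 ≤ v' l) (hX : AEMeasurable X Pr)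
    (hN : AEMeasurable N Pr) (hXl : Pr.map X = diagGaussian q m v)
    (hNl : Pr.map N = diagGaussian q m' v') (h : IndepFun X N Pr) (p f r f' : ι → ℝ) :
    Pr.map (fun ω => diagAffine q p f (X ω) + diagAffine q r f' (N ω))
      = diagGaussian q (fun l => (p l * m l + f l) + (r l * m' l + f' l))
        fun l => p l ^ 2 * v l + r l ^ 2 * v' l := by
  refine map_add_diagGaussian q (fun l => mul_nonneg (sq_nonneg (p l)) (hv l))
    (fun l => mul_nonneg (sq_nonneg (r l)) (hv' l))
    ((measurable_diagAffine q p f).comp_aemeasurable hX)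
    ((measurable_diagAffine q r f').comp_aemeasurable hN) ?_ ?_
    (h.comp (measurable_diagAffine q p f) (measurable_diagAffine q r f'))
  · rw [← diagGaussian_map_diagAffine, ← hXl,
      AEMeasurable.map_map_of_aemeasurable (by fun_prop) hX]
    rfl
  · rw [← diagGaussian_map_diagAffine, ← hNl,
      AEMeasurable.map_map_of_aemeasurable (by fun_prop) hN]
    rfl

omit [FiniteDimensional ℝ E] [MeasurableSpace E] [BorelSpace E] in
theorem inner_diagAffine_zero_left (q : OrthonormalBasis ι ℝ E) (p : ι → ℝ) (x y : E) :
    inner ℝ (diagAffine q p 0 x) y = inner ℝ x (diagAffine q p 0 y) := by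
  rw [← q.sum_inner_mul_inner, ← q.sum_inner_mul_inner]
  refine Finset.sum_congr rfl fun l _ => ?_
  rw [real_inner_comm, inner_diagAffine, inner_diagAffine, real_inner_comm x]
  simp only [Pi.zero_apply]
  ring

omit [IsProbabilityMeasure Pr] in
theorem charFun_map_eq_integral {F : Type*} [NormedAddCommGroup F] [InnerProductSpace ℝ F]
    [MeasurableSpace F] [BorelSpace F] [SecondCountableTopology F] {Y : Ω → F}
    (hY : AEMeasurable Y Pr) (t : F) :
    charFun (Pr.map Y) t = ∫ ω, Complex.exp (inner ℝ (Y ω) t * Complex.I) ∂Pr := by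
  rw [charFun_apply, integral_map hY (Measurable.aestronglyMeasurable (by fun_prop))]

/-- Two diagonal linear combinations of independent diagonal Gaussian vectors are independent as
soon as they are uncorrelated. -/
theorem indepFun_diagAffine_of_uncorrelated (q : OrthonormalBasis ι ℝ E) {X N : Ω → E}
    {m v m' v' : ι → ℝ} (hv : ∀ l, 0 ≤ v l) (hv' : ∀ l, 0 ≤ v' l) (hX : AEMeasurable X Pr)
    (hN : AEMeasurable N Pr) (hXl : Pr.map X = diagGaussian q m v)
    (hNl : Pr.map N = diagGaussian q m' v') (h : IndepFun X N Pr) (p r p' r' : ι → ℝ)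
    (hcov : ∀ l, p l * p' l * v l + r l * r' l * v' l = 0) :
    IndepFun (fun ω => diagAffine q p 0 (X ω) + diagAffine q r 0 (N ω))
      (fun ω => diagAffine q p' 0 (X ω) + diagAffine q r' 0 (N ω)) Pr := by
  have hXa : ∀ p, AEMeasurable (fun ω => diagAffine q p 0 (X ω)) Pr := fun p =>
    (measurable_diagAffine q p 0).comp_aemeasurable hX
  have hNa : ∀ p, AEMeasurable (fun ω => diagAffine q p 0 (N ω)) Pr := fun p =>
    (measurable_diagAffine q p 0).comp_aemeasurable hN
  have hadd : ∀ p r, AEMeasurable (fun ω => diagAffine q p 0 (X ω) + diagAffine q r 0 (N ω)) Pr :=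
    fun p r => (hXa p).add (hNa r)
  rw [indepFun_iff_charFun_prod (hadd p r) (hadd p' r')]
  intro t
  -- Diagonal linear maps are self-adjoint, so they move from the random vectors to the frequency,
  -- where independence of X and N applies.
  have hpull : charFun (Pr.map fun ω => WithLp.toLp 2
        (diagAffine q p 0 (X ω) + diagAffine q r 0 (N ω),
          diagAffine q p' 0 (X ω) + diagAffine q r' 0 (N ω))) t
      = charFun (Pr.map fun ω => WithLp.toLp 2 (X ω, N ω))
        (WithLp.toLp 2 (diagAffine q p 0 t.ofLp.1 + diagAffine q p' 0 t.ofLp.2,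
          diagAffine q r 0 t.ofLp.1 + diagAffine q r' 0 t.ofLp.2)) := by
    have hpair : ∀ {Y W : Ω → E}, AEMeasurable Y Pr → AEMeasurable W Pr →
        AEMeasurable (fun ω => WithLp.toLp 2 (Y ω, W ω)) Pr := fun hY hW =>
      (WithLp.measurable_toLp 2 _).comp_aemeasurable (hY.prodMk hW)
    rw [charFun_map_eq_integral (hpair (hadd p r) (hadd p' r')),
      charFun_map_eq_integral (hpair hX hN)]
    refine integral_congr_ae (Filter.Eventually.of_forall fun ω => ?_)
    beta_reduce
    congr 3
    simp only [WithLp.prod_inner_apply, inner_add_left, inner_add_right,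
      inner_diagAffine_zero_left]
    ring
  rw [hpull, (indepFun_iff_charFun_prod hX hN).1 h,
    map_diagAffine_add_diagAffine q hv hv' hX hN hXl hNl h,
    map_diagAffine_add_diagAffine q hv hv' hX hN hXl hNl h, hXl, hNl,
    charFun_diagGaussian q _ hv, charFun_diagGaussian q _ hv',
    charFun_diagGaussian q _ fun l => add_nonneg (mul_nonneg (sq_nonneg _) (hv l))
      (mul_nonneg (sq_nonneg _) (hv' l)),
    charFun_diagGaussian q _ fun l => add_nonneg (mul_nonneg (sq_nonneg _) (hv l))
      (mul_nonneg (sq_nonneg _) (hv' l)), ← Finset.prod_mul_distrib, ← Finset.prod_mul_distrib]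
  refine Finset.prod_congr rfl fun l _ => ?_
  rw [← Complex.exp_add, ← Complex.exp_add]
  congr 1
  simp only [inner_add_right, inner_diagAffine, Pi.zero_apply]
  -- The joint exponent and the sum of the marginal ones differ only by the cross term, which is
  -- proportional to the covariance.
  have hc : (p l * p' l * v l + r l * r' l * v' l : ℂ) = 0 := by exact_mod_cast hcov l
  push_cast
  linear_combination (-(inner ℝ (q l) t.ofLp.1 : ℂ) * (inner ℝ (q l) t.ofLp.2 : ℂ)) * hc

/-- The cross term vanishes because the Gaussian is centered. -/
theorem lintegral_enorm_add_sq_diagGaussian (q : OrthonormalBasis ι ℝ E) {v : ι → ℝ}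
    (hv : ∀ l, 0 ≤ v l) (w : E) :
    ∫⁻ u, ‖u + w‖ₑ ^ 2 ∂(diagGaussian q 0 v) = ENNReal.ofReal (∑ l, v l) + ‖w‖ₑ ^ 2 := by
  have he : ∀ u, u + w = diagAffine q 1 (fun l => inner ℝ (q l) w) u := by
    intro u
    refine ext_inner_basis q fun l => ?_
    simp [inner_add_right]
  simp_rw [he]
  rw [← lintegral_map (f := fun x => ‖x‖ₑ ^ 2) (by fun_prop) (measurable_diagAffine q _ _),
    diagGaussian_map_diagAffine, lintegral_enorm_sq_diagGaussian q _
      fun l => mul_nonneg (sq_nonneg _) (hv l), Finset.sum_add_distrib, add_comm,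
    ENNReal.ofReal_add (Finset.sum_nonneg fun l _ => mul_nonneg (sq_nonneg _) (hv l))
      (Finset.sum_nonneg fun l _ => sq_nonneg _), enorm_sq_eq_sum q w,
    ENNReal.ofReal_sum_of_nonneg fun l _ => sq_nonneg _]
  simp

/-- If `X = U + B(Z)` with a centered Gaussian `U` independent of `Z`, then the distortion of a
randomized reconstruction from `Z` splits into the distortion of `B(Z)` and the mean squared
distance of the reconstruction to `B(Z)`. -/
theorem kernelMse_eq_add (q : OrthonormalBasis ι ℝ E) {v : ι → ℝ} (hv : ∀ l, 0 ≤ v l)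
    {X U Z : Ω → E} {B : E → E} (hB : Measurable B) (hU : AEMeasurable U Pr)
    (hZ : AEMeasurable Z Pr) (hUl : Pr.map U = diagGaussian q 0 v) (hUZ : IndepFun U Z Pr)
    (hX : ∀ ω, X ω = U ω + B (Z ω)) (κ : Kernel E E) [IsMarkovKernel κ] :
    kernelMse Pr X Z κ
      = ENNReal.ofReal (∑ l, v l) + ∫⁻ y, ‖B y.1 - y.2‖ₑ ^ 2 ∂(Pr.map Z ⊗ₘ κ) := by
  have hZp : IsProbabilityMeasure (Pr.map Z) := Measure.isProbabilityMeasure_map hZ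
  have hF : Measurable fun y : E × E => ∫⁻ x', ‖y.1 + B y.2 - x'‖ₑ ^ 2 ∂(κ y.2) := by
    have h := Measurable.lintegral_kernel_prod_right' (κ := κ.comap (Prod.snd : E × E → E)
      measurable_snd) (f := fun y : (E × E) × E => ‖y.1.1 + B y.1.2 - y.2‖ₑ ^ 2) (by fun_prop)
    simpa using h
  calc kernelMse Pr X Z κ
      = ∫⁻ y, ∫⁻ x', ‖y.1 + B y.2 - x'‖ₑ ^ 2 ∂(κ y.2) ∂(Pr.map fun ω => (U ω, Z ω)) := by
        rw [lintegral_map' hF.aemeasurable (hU.prodMk hZ), kernelMse]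
        simp_rw [hX]
    _ = ∫⁻ z, ∫⁻ u, ∫⁻ x', ‖u + B z - x'‖ₑ ^ 2 ∂(κ z) ∂(diagGaussian q 0 v) ∂(Pr.map Z) := by
        rw [(indepFun_iff_map_prod_eq_prod_map_map hU hZ).1 hUZ, hUl,
          lintegral_prod_symm _ hF.aemeasurable]
    _ = ∫⁻ z, ∫⁻ x', (ENNReal.ofReal (∑ l, v l) + ‖B z - x'‖ₑ ^ 2) ∂(κ z) ∂(Pr.map Z) := by
        refine lintegral_congr fun z => ?_
        -- For fixed z, integrating over u first leaves a centered Gaussian shifted by the constant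
        -- B z - x'.
        rw [lintegral_lintegral_swap (by fun_prop)]
        refine lintegral_congr fun x' => ?_
        simp_rw [add_sub_assoc]
        exact lintegral_enorm_add_sq_diagGaussian q hv _
    _ = ∫⁻ y, (ENNReal.ofReal (∑ l, v l) + ‖B y.1 - y.2‖ₑ ^ 2) ∂(Pr.map Z ⊗ₘ κ) := by
        rw [Measure.lintegral_compProd (by fun_prop)]
    _ = _ := by
        rw [lintegral_add_left measurable_const, lintegral_const, measure_univ, mul_one]

end Decomposition

/-! ### Euclidean geometry of standard deviations. -/

section Algebra

variable {d : ℕ}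

theorem sqrt_sum_sq_sub_le (x y z : Fin d → ℝ) :
    √(∑ l, (x l - z l) ^ 2) ≤ √(∑ l, (x l - y l) ^ 2) + √(∑ l, (y l - z l) ^ 2) := by
  have h : ∀ u w : Fin d → ℝ, √(∑ l, (u l - w l) ^ 2)
      = ‖(WithLp.toLp 2 u - WithLp.toLp 2 w : EuclideanSpace ℝ (Fin d))‖ := by
    intro u w
    simp [EuclideanSpace.norm_eq]
  rw [h, h, h]
  exact norm_sub_le_norm_sub_add_norm_sub _ _ _

/-- The standard deviation of the minimum mean squared error reconstruction in an
eigen-direction. -/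
def mmseStd (β : ℕ → ℝ) (t : ℕ) (lam : ℝ) : ℝ := √(alphaBar β t) * lam / √(eigVar β t lam)

variable {β : ℕ → ℝ} {t : ℕ} (hβ : ∀ k < t, 0 ≤ β (k + 1) ∧ β (k + 1) < 1)
include hβ

omit hβ in
theorem mmseStd_nonneg {lam : ℝ} (hlam : 0 < lam) : 0 ≤ mmseStd β t lam := by
  unfold mmseStd
  positivity

/-- The ratio of the two sides is the correlation between a coordinate of X and that of Z_t, which
is at most 1. -/
theorem mmseStd_le_sqrt {lam : ℝ} (hlam : 0 < lam) : mmseStd β t lam ≤ √lam := by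
  have hv := eigVar_pos hβ hlam
  have ha := alphaBar_pos fun k hk => (hβ k hk).2
  rw [mmseStd, div_le_iff₀ (Real.sqrt_pos.2 hv)]
  have h : √(alphaBar β t) * √lam ≤ √(eigVar β t lam) := by
    rw [← Real.sqrt_mul ha.le]
    refine Real.sqrt_le_sqrt ?_
    rw [eigVar]
    linarith [alphaBar_le_one hβ]
  calc √(alphaBar β t) * lam = √lam * (√(alphaBar β t) * √lam) := by
        nth_rewrite 1 [← Real.mul_self_sqrt hlam.le]
        ring
    _ ≤ _ := by gcongr

/-- This identifies √S as a Euclidean distance, so that the tradeoff becomes a triangle inequality.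
-/
theorem critPerception_eq {lam : Fin d → ℝ} (hlam : ∀ l, 0 < lam l) :
    critPerception β t lam = ∑ l, (√(lam l) - mmseStd β t (lam l)) ^ 2 := by
  refine Finset.sum_congr rfl fun l _ => ?_
  have hv := eigVar_pos hβ (hlam l)
  have hsv := Real.sqrt_pos.2 hv
  have hsl := Real.sqrt_pos.2 (hlam l)
  have hv2 := Real.sq_sqrt hv.le
  have hl2 := Real.sq_sqrt (hlam l).le
  rw [mmseStd]
  generalize √(eigVar β t (lam l)) = s at *
  generalize √(lam l) = r at *
  rw [← hv2, ← hl2]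
  field_simp

theorem residual_nonneg {lam : ℝ} (hlam : 0 < lam) :
    0 ≤ (1 - alphaBar β t) * lam / eigVar β t lam := by
  have hv := eigVar_pos hβ hlam
  have := sub_nonneg.2 (alphaBar_le_one hβ)
  positivity

/-- The mean squared error of a linear reconstruction in an eigen-direction, as a function of the
standard deviation `s` of the reconstruction. -/
theorem linear_mse_eq {lam : ℝ} (hlam : 0 < lam) (s : ℝ) :
    (1 - s / √(eigVar β t lam) * √(alphaBar β t)) ^ 2 * lam
        + (-(s / √(eigVar β t lam) * √(1 - alphaBar β t))) ^ 2
      = (mmseStd β t lam - s) ^ 2 + (1 - alphaBar β t) * lam / eigVar β t lam := by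
  have hv := eigVar_pos hβ hlam
  have hsv := Real.sqrt_pos.2 hv
  have hv2 := Real.sq_sqrt hv.le
  have ha := Real.sq_sqrt (alphaBar_pos fun k hk => (hβ k hk).2).le
  have hb := Real.sq_sqrt (sub_nonneg.2 (alphaBar_le_one hβ))
  have hdef : √(eigVar β t lam) ^ 2 = √(alphaBar β t) ^ 2 * lam + √(1 - alphaBar β t) ^ 2 := by
    rw [hv2, ha, hb, eigVar]
  have h1 : (1 - alphaBar β t) * lam / eigVar β t lam
      = √(1 - alphaBar β t) ^ 2 * lam / √(eigVar β t lam) ^ 2 := by rw [hb, hv2]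
  rw [h1, mmseStd]
  generalize √(eigVar β t lam) = s' at *
  generalize √(alphaBar β t) = a at *
  generalize √(1 - alphaBar β t) = b at *
  field_simp
  linear_combination (lam - s ^ 2) * hdef

end Algebra

/-! ### Affine decoders, the conditional mean and the lower bound. -/

section Reconstruction

variable {d : ℕ} {Ω : Type*} [MeasurableSpace Ω] {Pr : Measure Ω} [IsProbabilityMeasure Pr]
  {q : OrthonormalBasis (Fin d) ℝ (EuclideanSpace ℝ (Fin d))}
  {X N : Ω → EuclideanSpace ℝ (Fin d)} {m lam : Fin d → ℝ} {β : ℕ → ℝ} {t : ℕ}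

omit [MeasurableSpace Ω] in
theorem noised_eq_diagAffine (q : OrthonormalBasis (Fin d) ℝ (EuclideanSpace ℝ (Fin d)))
    (X N : Ω → EuclideanSpace ℝ (Fin d)) (β : ℕ → ℝ) (t : ℕ) :
    noised β X N t = fun ω => diagAffine q (fun _ => √(alphaBar β t)) 0 (X ω)
      + diagAffine q (fun _ => √(1 - alphaBar β t)) 0 (N ω) := by
  ext1 ω
  refine ext_inner_basis q fun l => ?_
  simp [noised, inner_add_right, inner_smul_right]

variable (hlam : ∀ l, 0 < lam l) (hX : AEMeasurable X Pr) (hN : AEMeasurable N Pr)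
  (hXl : Pr.map X = diagGaussian q m lam) (hNl : Pr.map N = diagGaussian q 0 1)
  (hXN : IndepFun X N Pr)
  (hβ : ∀ k < t, 0 ≤ β (k + 1) ∧ β (k + 1) < 1)
include hX hN

omit [IsProbabilityMeasure Pr] in
theorem aemeasurable_noised : AEMeasurable (noised β X N t) Pr :=
  (measurable_const_smul (√(alphaBar β t))).comp_aemeasurable hX |>.add <|
    (measurable_const_smul (√(1 - alphaBar β t))).comp_aemeasurable hN

include hXl hNl hXN hlam

theorem map_diagAffine_add_diagAffine_noise (p f r : Fin d → ℝ) :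
    Pr.map (fun ω => diagAffine q p f (X ω) + diagAffine q r 0 (N ω))
      = diagGaussian q (fun l => p l * m l + f l) fun l => p l ^ 2 * lam l + r l ^ 2 := by
  rw [map_diagAffine_add_diagAffine q (fun l => (hlam l).le) (fun _ => zero_le_one) hX hN hXl hNl
    hXN]
  simp

include hβ

theorem map_noised :
    Pr.map (noised β X N t)
      = diagGaussian q (fun l => √(alphaBar β t) * m l) fun l => eigVar β t (lam l) := by
  rw [noised_eq_diagAffine q, map_diagAffine_add_diagAffine_noise hlam hX hN hXl hNl hXN]
  congr 1
  · simp
  · ext l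
    rw [Real.sq_sqrt (alphaBar_pos fun k hk => (hβ k hk).2).le,
      Real.sq_sqrt (sub_nonneg.2 (alphaBar_le_one hβ)), eigVar]

/-- The linear reconstruction from `Z_t` whose mean is that of `X` and whose standard deviation
along `q l` is `s l`. -/
def linearDecoder (q : OrthonormalBasis (Fin d) ℝ (EuclideanSpace ℝ (Fin d))) (β : ℕ → ℝ) (t : ℕ)
    (m lam s : Fin d → ℝ) : EuclideanSpace ℝ (Fin d) → EuclideanSpace ℝ (Fin d) :=
  diagAffine q (fun l => s l / √(eigVar β t (lam l)))
    fun l => m l - s l / √(eigVar β t (lam l)) * (√(alphaBar β t) * m l)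

omit hlam hX hN hXl hNl hXN hβ in
@[fun_prop]
theorem measurable_linearDecoder (s : Fin d → ℝ) : Measurable (linearDecoder q β t m lam s) :=
  measurable_diagAffine q _ _

theorem map_linearDecoder_noised (s : Fin d → ℝ) :
    (Pr.map (noised β X N t)).map (linearDecoder q β t m lam s)
      = diagGaussian q m fun l => s l ^ 2 := by
  rw [map_noised hlam hX hN hXl hNl hXN hβ, linearDecoder, diagGaussian_map_diagAffine]
  congr 1
  · simp
  · ext l
    have hv := eigVar_pos hβ (hlam l)
    rw [div_pow, Real.sq_sqrt hv.le, div_mul_cancel₀ _ hv.ne']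

omit hlam hX hN hXl hNl hXN hβ [MeasurableSpace Ω] in
theorem sub_linearDecoder_noised (s : Fin d → ℝ) (ω : Ω) :
    X ω - linearDecoder q β t m lam s (noised β X N t ω)
      = diagAffine q (fun l => 1 - s l / √(eigVar β t (lam l)) * √(alphaBar β t))
          (fun l => -(m l - s l / √(eigVar β t (lam l)) * (√(alphaBar β t) * m l))) (X ω)
        + diagAffine q (fun l => -(s l / √(eigVar β t (lam l)) * √(1 - alphaBar β t))) 0 (N ω) := by
  refine ext_inner_basis q fun l => ?_
  simp only [linearDecoder, noised, inner_sub_right, inner_add_right, inner_diagAffine,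
    inner_smul_right, Pi.zero_apply]
  ring

theorem map_sub_linearDecoder_noised (s : Fin d → ℝ) :
    Pr.map (fun ω => X ω - linearDecoder q β t m lam s (noised β X N t ω))
      = diagGaussian q 0 fun l => (mmseStd β t (lam l) - s l) ^ 2
        + (1 - alphaBar β t) * lam l / eigVar β t (lam l) := by
  simp_rw [sub_linearDecoder_noised]
  rw [map_diagAffine_add_diagAffine_noise hlam hX hN hXl hNl hXN]
  congr 1
  · ext l
    simp only [Pi.zero_apply]
    ring
  · ext l
    exact linear_mse_eq hβ (hlam l) (s l)

theorem mse_linearDecoder (s : Fin d → ℝ) :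
    mse Pr X (fun ω => linearDecoder q β t m lam s (noised β X N t ω))
      = ENNReal.ofReal (∑ l, (mmseStd β t (lam l) - s l) ^ 2
        + ∑ l, (1 - alphaBar β t) * lam l / eigVar β t (lam l)) := by
  have hmeas : AEMeasurable (fun ω => X ω - linearDecoder q β t m lam s (noised β X N t ω)) Pr :=
    hX.sub ((measurable_linearDecoder s).comp_aemeasurable (aemeasurable_noised hX hN))
  rw [mse, ← lintegral_map' (f := fun x => ‖x‖ₑ ^ 2) (by fun_prop) hmeas,
    map_sub_linearDecoder_noised hlam hX hN hXl hNl hXN hβ, lintegral_enorm_sq_diagGaussian q _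
      fun l => add_nonneg (sq_nonneg _) (residual_nonneg hβ (hlam l))]
  simp [Finset.sum_add_distrib]

theorem W2sq_linearDecoder {s : Fin d → ℝ} (hs : ∀ l, 0 ≤ s l) :
    W2sq (Pr.map X) (Pr.map fun ω => linearDecoder q β t m lam s (noised β X N t ω))
      = ENNReal.ofReal (∑ l, (√(lam l) - s l) ^ 2) := by
  have h := map_linearDecoder_noised hlam hX hN hXl hNl hXN hβ s
  rw [AEMeasurable.map_map_of_aemeasurable (measurable_linearDecoder s).aemeasurable
    (aemeasurable_noised hX hN)] at h
  change Pr.map (fun ω => linearDecoder q β t m lam s (noised β X N t ω)) = _ at h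
  rw [h, hXl, W2sq_diagGaussian q m hlam fun l => sq_nonneg _]
  simp_rw [Real.sqrt_sq (hs _)]

theorem indepFun_mmse_residual_noised :
    IndepFun (fun ω => X ω - linearDecoder q β t m lam (fun l => mmseStd β t (lam l))
      (noised β X N t ω)) (noised β X N t) Pr := by
  set g : Fin d → ℝ := fun l => mmseStd β t (lam l) / √(eigVar β t (lam l)) with hg
  have h := indepFun_diagAffine_of_uncorrelated q (fun l => (hlam l).le) (fun _ => zero_le_one)
    hX hN hXl hNl hXN (fun l => 1 - g l * √(alphaBar β t))
    (fun l => -(g l * √(1 - alphaBar β t))) (fun _ => √(alphaBar β t))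
    (fun _ => √(1 - alphaBar β t)) (fun l => by
      have hv := eigVar_pos hβ (hlam l)
      have ha := Real.sq_sqrt (alphaBar_pos fun k hk => (hβ k hk).2).le
      have hb := Real.sq_sqrt (sub_nonneg.2 (alphaBar_le_one hβ))
      -- The orthogonality principle: `g l` is the regression coefficient, the covariance of X and
      -- Z_t divided by the variance of Z_t.
      have hgv : g l * eigVar β t (lam l) = √(alphaBar β t) * lam l := by
        change mmseStd β t (lam l) / √(eigVar β t (lam l)) * _ = _
        rw [mmseStd, div_div, ← sq, Real.sq_sqrt hv.le, div_mul_cancel₀ _ hv.ne']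
      rw [eigVar] at hgv
      linear_combination (-(g l) * lam l) * ha - g l * hb - hgv)
  rw [← noised_eq_diagAffine q] at h
  -- The independence above concerns maps without shift; the constant part of the residual is
  -- restored afterwards.
  have h2 := h.comp (φ := diagAffine q 1 fun l => -(m l - g l * (√(alphaBar β t) * m l)))
    (measurable_diagAffine q _ _) measurable_id
  rw [Function.id_comp] at h2
  convert h2 using 1
  ext1 ω
  refine ext_inner_basis q fun l => ?_
  rw [sub_linearDecoder_noised]
  simp only [Function.comp_apply, inner_diagAffine, inner_add_right, Pi.zero_apply, Pi.one_apply,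
    hg]
  ring

theorem closedForm_le_kernelMse {P : ℝ} (hP : 0 ≤ P)
    (κ : Kernel (EuclideanSpace ℝ (Fin d)) (EuclideanSpace ℝ (Fin d))) [IsMarkovKernel κ]
    (hκ : W2sq (Pr.map X) ((Pr.map (noised β X N t)).bind κ) ≤ ENNReal.ofReal P) :
    ENNReal.ofReal (closedForm β t lam P) ≤ kernelMse Pr X (noised β X N t) κ := by
  set B := linearDecoder q β t m lam fun l => mmseStd β t (lam l) with hB
  have hBm : Measurable B := measurable_linearDecoder _
  have hZ : AEMeasurable (noised β X N t) Pr := aemeasurable_noised hX hN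
  have hZp : IsProbabilityMeasure (Pr.map (noised β X N t)) := Measure.isProbabilityMeasure_map hZ
  set ν := (Pr.map (noised β X N t)).bind κ with hν
  -- The moments are taken around the mean `m` of X, which is also the mean of B(Z_t), and not
  -- around the mean of `ν`. Thus no assumption on the mean or shape of `ν` is needed.
  set s : Fin d → ℝ := fun l => √(∫ y, (inner ℝ (q l) y - m l) ^ 2 ∂ν) with hs
  have hres := map_sub_linearDecoder_noised hlam hX hN hXl hNl hXN hβ
    fun l => mmseStd β t (lam l)
  simp only [sub_self, ne_eq, OfNat.ofNat_ne_zero, not_false_eq_true, zero_pow, zero_add] at hres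
  rw [kernelMse_eq_add q (fun l => residual_nonneg hβ (hlam l)) hBm
    (hX.sub (hBm.comp_aemeasurable hZ)) hZ hres
    (indepFun_mmse_residual_noised hlam hX hN hXl hNl hXN hβ) (fun ω => by simp [hB])]
  have hperc : ∑ l, (√(lam l) - s l) ^ 2 ≤ P := by
    rw [hXl] at hκ
    exact (ENNReal.ofReal_le_ofReal_iff hP).1
      ((le_W2sq_diagGaussian q m (fun l => (hlam l).le) ν).trans hκ)
  have hdist : ENNReal.ofReal (∑ l, (mmseStd β t (lam l) - s l) ^ 2)
      ≤ ∫⁻ y, ‖B y.1 - y.2‖ₑ ^ 2 ∂(Pr.map (noised β X N t) ⊗ₘ κ) := by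
    have hmap : Measurable fun y : EuclideanSpace ℝ (Fin d) × EuclideanSpace ℝ (Fin d) =>
        (B y.1, y.2) := by fun_prop
    -- The law of (B(Z_t), X̂) is a coupling of a Gaussian with mean `m` and `ν`, to which the
    -- second moment bound applies.
    have hfst : ((Pr.map (noised β X N t) ⊗ₘ κ).map fun y => (B y.1, y.2)).fst
        = diagGaussian q m fun l => mmseStd β t (lam l) ^ 2 := by
      rw [Measure.fst_map_prodMk measurable_snd,
        ← map_linearDecoder_noised hlam hX hN hXl hNl hXN hβ]
      nth_rewrite 2 [← Measure.fst_compProd (Pr.map (noised β X N t)) κ]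
      rw [Measure.fst, Measure.map_map hBm measurable_fst]
      rfl
    have hsnd : ((Pr.map (noised β X N t) ⊗ₘ κ).map fun y => (B y.1, y.2)).snd = ν := by
      rw [Measure.snd_map_prodMk (X := fun y : _ × _ => B y.1) (hBm.comp measurable_fst), ← Measure.snd, Measure.snd_compProd]
    have h := le_lintegral_coupling q m (fun l => sq_nonneg _) hfst
    rw [hsnd, lintegral_map (by fun_prop) hmap] at h
    simp_rw [Real.sqrt_sq (mmseStd_nonneg (hlam _))] at h
    exact h
  refine le_trans ?_ (add_le_add_right hdist _)
  have hr : 0 ≤ ∑ l, (1 - alphaBar β t) * lam l / eigVar β t (lam l) :=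
    Finset.sum_nonneg fun l _ => residual_nonneg hβ (hlam l)
  rw [← ENNReal.ofReal_add hr (Finset.sum_nonneg fun l _ => sq_nonneg _), closedForm, add_comm]
  refine ENNReal.ofReal_le_ofReal (add_le_add_right ?_ _)
  have htri := sqrt_sum_sq_sub_le (fun l => √(lam l)) s fun l => mmseStd β t (lam l)
  rw [← critPerception_eq hβ hlam] at htri
  have hcomm : ∑ l, (s l - mmseStd β t (lam l)) ^ 2 = ∑ l, (mmseStd β t (lam l) - s l) ^ 2 :=
    Finset.sum_congr rfl fun l _ => by ring
  rw [hcomm] at htri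
  have h1 := Real.sqrt_le_sqrt hperc
  calc max (√(critPerception β t lam) - √P) 0 ^ 2
      ≤ √(∑ l, (mmseStd β t (lam l) - s l) ^ 2) ^ 2 := by
        refine pow_le_pow_left₀ (le_max_right _ _) (max_le ?_ (Real.sqrt_nonneg _)) 2
        linarith
    _ = _ := Real.sq_sqrt (Finset.sum_nonneg fun l _ => sq_nonneg _)

end Reconstruction

/-! ### The optimal point on the segment. -/

section Interpolation

variable {d : ℕ} {lam : Fin d → ℝ} {β : ℕ → ℝ} {t : ℕ}

/-- Standard deviations between those of the source and those of the minimum mean squared error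
reconstruction, which are optimal for the perception level `P`. -/
theorem exists_optimal_std (hlam : ∀ l, 0 < lam l)
    (hβ : ∀ k < t, 0 ≤ β (k + 1) ∧ β (k + 1) < 1) {P : ℝ} (hP : 0 ≤ P) :
    ∃ s : Fin d → ℝ, (∀ l, mmseStd β t (lam l) ≤ s l ∧ s l ≤ √(lam l)) ∧
      ∑ l, (√(lam l) - s l) ^ 2 = min P (critPerception β t lam) ∧
      ∑ l, (mmseStd β t (lam l) - s l) ^ 2 = max (√(critPerception β t lam) - √P) 0 ^ 2 := by
  set S := critPerception β t lam with hSdef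
  have hS := critPerception_eq hβ hlam
  rw [← hSdef] at hS
  -- θ is the fraction of the segment from (√λ_l) to the `mmseStd` vector that the budget allows: 1
  -- if S ≤ P, and √P / √S otherwise. P = 0 is treated apart because S may then vanish too.
  obtain ⟨θ, hθ0, hθ1, h1, h2⟩ : ∃ θ : ℝ, 0 ≤ θ ∧ θ ≤ 1 ∧ θ ^ 2 * S = min P S ∧
      (1 - θ) ^ 2 * S = max (√S - √P) 0 ^ 2 := by
    rcases le_total S P with h | h
    · refine ⟨1, zero_le_one, le_rfl, by simp [h], ?_⟩
      simp [Real.sqrt_le_sqrt h]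
    · rcases hP.eq_or_lt with rfl | hP'
      · refine ⟨0, le_rfl, zero_le_one, by simp [h], ?_⟩
        simp [Real.sq_sqrt h]
      have hS0 := hP'.trans_le h
      have hsS := Real.sqrt_pos.2 hS0
      have hle := Real.sqrt_le_sqrt h
      refine ⟨√P / √S, by positivity, (div_le_one hsS).2 hle, ?_, ?_⟩
      · rw [div_pow, Real.sq_sqrt hP, Real.sq_sqrt hS0.le, min_eq_left h,
          div_mul_cancel₀ _ hS0.ne']
      · rw [max_eq_left (sub_nonneg.2 hle)]
        nth_rewrite 2 [← Real.sq_sqrt hS0.le]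
        field_simp
  refine ⟨fun l => √(lam l) + θ * (mmseStd β t (lam l) - √(lam l)), fun l => ?_, ?_, ?_⟩
  · have := mmseStd_le_sqrt hβ (hlam l)
    constructor <;> nlinarith
  · rw [← h1, hS, Finset.mul_sum]
    exact Finset.sum_congr rfl fun l _ => by ring
  · rw [← h2, hS, Finset.mul_sum]
    exact Finset.sum_congr rfl fun l _ => by ring

end Interpolation

end ScoreScaledODE

end

/-! ### Assembly of the tradeoff and the iteration. -/

theorem theorem1 {d : ℕ} {Ω : Type*} [MeasurableSpace Ω] (Pr : Measure Ω) [IsProbabilityMeasure Pr]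
    (μ₀ : EuclideanSpace ℝ (Fin d)) (Sigma₀ : Matrix (Fin d) (Fin d) ℝ) (hSigma : Sigma₀.PosDef)
    (q : OrthonormalBasis (Fin d) ℝ (EuclideanSpace ℝ (Fin d))) (lam : Fin d → ℝ)
    (hq : ∀ l, Matrix.toEuclideanLin Sigma₀ (q l) = lam l • q l)
    (X N : Ω → EuclideanSpace ℝ (Fin d))
    (hX : HasLaw X (multivariateGaussian μ₀ Sigma₀) Pr)
    (hN : HasLaw N (stdGaussian (EuclideanSpace ℝ (Fin d))) Pr)
    (hXN : IndepFun X N Pr)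
    (T : ℕ) (β : ℕ → ℝ) (hβ0 : β 0 = 0) (hβ : ∀ k < T, β k ≤ β (k + 1)) (hβT : β T < 1)
    (t : ℕ) (ht : 1 ≤ t) (htT : t ≤ T) (P : ℝ) (hP : 0 ≤ P) :
    -- the closed form is the optimal tradeoff
    IsLeast (ScoreScaledODE.feasibleDistortions Pr X (ScoreScaledODE.noised β X N t) P)
      (ENNReal.ofReal (ScoreScaledODE.closedForm β t lam P)) ∧
    -- and the per-dimension score-scaled iteration achieves it
    ∃ ρ : Fin d → ℝ, (∀ l, ρ l ∈ Set.Icc (0 : ℝ) 1) ∧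
      ∃ dec : EuclideanSpace ℝ (Fin d) → EuclideanSpace ℝ (Fin d),
        dec = ScoreScaledODE.odeDecode q ρ β
          (fun k => Pr.map (ScoreScaledODE.noised β X N k)) t ∧
        Measurable dec ∧
        ScoreScaledODE.W2sq (Pr.map X)
            (Pr.map (fun ω => dec (ScoreScaledODE.noised β X N t ω))) =
          ENNReal.ofReal (min P (ScoreScaledODE.critPerception β t lam)) ∧
        ScoreScaledODE.mse Pr X (fun ω => dec (ScoreScaledODE.noised β X N t ω)) =
          ENNReal.ofReal (ScoreScaledODE.closedForm β t lam P) := by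
  open ScoreScaledODE in
  have hlam := eigenvalue_pos hSigma hq
  have hXl := hX.map_eq.trans (multivariateGaussian_eq_diagGaussian hSigma hq μ₀)
  have hNl := hN.map_eq.trans (stdGaussian_eq_diagGaussian q)
  set m : Fin d → ℝ := fun l => inner ℝ (q l) μ₀
  have hmono : ∀ j ≤ T, ∀ k ≤ j, β k ≤ β j := by
    intro j hj k hk
    induction j, hk using Nat.le_induction with
    | base => exact le_rfl
    | succ j hkj ih => exact (ih (by omega)).trans (hβ j (by omega))
  have hb : ∀ k < t, 0 ≤ β (k + 1) ∧ β (k + 1) < 1 := fun k hk =>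
    ⟨hβ0 ▸ hmono (k + 1) (by omega) 0 (by omega), (hmono T le_rfl (k + 1) (by omega)).trans_lt hβT⟩
  obtain ⟨s, hs, hsW, hsD⟩ := exists_optimal_std hlam hb hP
  have hs0 : ∀ l, 0 ≤ s l := fun l => (mmseStd_nonneg (hlam l)).trans (hs l).1
  have hW := W2sq_linearDecoder hlam hX.aemeasurable hN.aemeasurable hXl hNl hXN hb hs0
  have hD := mse_linearDecoder hlam hX.aemeasurable hN.aemeasurable hXl hNl hXN hb s
  rw [hsW] at hW
  rw [hsD] at hD
  have hdec : Measurable (linearDecoder q β t m lam s) := measurable_linearDecoder s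
  -- The minimum is attained by a deterministic reconstruction, the same affine decoder that the
  -- iteration produces below.
  refine ⟨⟨⟨Kernel.deterministic _ hdec, inferInstance, ?_, ?_⟩, ?_⟩, ?_⟩
  · rw [Measure.deterministic_comp_eq_map, AEMeasurable.map_map_of_aemeasurable
      hdec.aemeasurable (aemeasurable_noised hX.aemeasurable hN.aemeasurable)]
    exact hW.trans_le (ENNReal.ofReal_le_ofReal (min_le_left _ _))
  · rw [closedForm, ← hD, mse, kernelMse]
    refine lintegral_congr fun ω => ?_
    rw [Kernel.deterministic_apply, lintegral_dirac' _ (by fun_prop)]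
  · rintro D ⟨κ, hκ, hκP, rfl⟩
    exact closedForm_le_kernelMse hlam hX.aemeasurable hN.aemeasurable hXl hNl hXN hb hP κ hκP
  -- Dividing the bounds on `s l` by √λ_l^(t) places the target gain in the range covered by scales
  -- in [0, 1].
  · have hgain : ∀ l, ∃ r ∈ Set.Icc (0 : ℝ) 1,
        odeGain β (lam l) r t = s l / √(eigVar β t (lam l)) := by
      intro l
      have hv := eigVar_pos hb (hlam l)
      refine exists_odeGain_eq hb (hlam l) ?_ ?_
      · have h := div_le_div_of_nonneg_right (hs l).1 (Real.sqrt_nonneg (eigVar β t (lam l)))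
        rwa [mmseStd, div_div, Real.mul_self_sqrt hv.le] at h
      · exact div_le_div_of_nonneg_right (hs l).2 (Real.sqrt_nonneg _)
    choose ρ hρ hρg using hgain
    refine ⟨ρ, hρ, linearDecoder q β t m lam s, ?_, hdec, hW, hD⟩
    rw [odeDecode_diagGaussian q ρ hb m hlam fun k hk => map_noised hlam hX.aemeasurable
      hN.aemeasurable hXl hNl hXN fun j hj => hb j (by omega), linearDecoder]
    simp_rw [hρg]
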